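/- Let $\mathcal H$ be a complex Hilbert space, and let $T,T'\in\mathcal B(\mathcal H)$ be contractions ($\|T\|\le 1$, $\|T'\|\le 1$). For a contraction $A$ on $\mathcal H$ put $D_A=(I-A^*A)^{1/2}$ and $\mathcal D_A=\overline{D_A\mathcal H}$. For contractions $A,B$ on $\mathcal H$: - $A$ is *Harnack dominated* by $B$ if there is a constant $c\ge 1$ such that $\operatorname{Re}p(A)\le c\,\operatorname{Re}p(B)$ for every complex polynomial $p$ with $\operatorname{Re}p(z)\ge 0$ for all $|z|\le 1$, where $\operatorname{Re}X=\frac12(X+X^*)$; $A$ and $B$ are *Harnack equivalent* if each is Harnack dominated by the other. - $A$ is *Shmul'yan dominated* by $B$ if $A=B+D_{B^*}XD_B$ for some bounded operator $X:\mathcal D_B\to\mathcal D_{B^*}$; $A$ and $B$ are *Shmul'yan equivalent* if each is Shmul'yan dominated by the other. Suppose that $T^*$ is quasi-normal (that is, $T^*$ commutes with $TT^*$), that $T$ commutes with $T'$ and with $T'^*T'$, and that $T'$ commutes with $TT^*$. Then the following are equivalent: 1. $T$ is Harnack dominated by $T'$; 2. $T$ is Harnack equivalent to $T'$; 3. $T$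 is Shmul'yan equivalent to $T'$; 4. there exist a point $z_0$ of the open unit disc $\mathbb D$ and an analytic function $F:\mathbb D\to\mathcal B(\mathcal H)$ with $\|F(z)\|\le 1$ for all $z\in\mathbb D$, such that $F(0)=T$ and $F(z_0)=T'$; 5. there exists a bounded operator $B:\ell^2_{\mathbb N}(\mathcal D_{T'})\to\mathcal H$ such that $$T=T'+BJ'D_{T'}\quad\text{and}\quad BS'=TB,$$ where $J':\mathcal D_{T'}\to\ell^2_{\mathbb N}(\mathcal D_{T'})$, $x\mapsto(x,0,0,\dots)$, is the canonical inclusion and $S'$ is the forward shift $(x_0,x_1,\dots)\mapsto(0,x_0,x_1,\dots)$ on $\ell^2_{\mathbb N}(\mathcal D_{T'})$. -/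

import Mathlib

open scoped ComplexStarModule ENNReal InnerProductSpace

namespace HarnackShmulyan

noncomputable section

variable {H₁ H₂ H : Type*}
  [NormedAddCommGroup H₁] [InnerProductSpace ℂ H₁] [CompleteSpace H₁]
  [NormedAddCommGroup H₂] [InnerProductSpace ℂ H₂] [CompleteSpace H₂]
  [NormedAddCommGroup H] [InnerProductSpace ℂ H] [CompleteSpace H]

/-- `A` is quasi-normal if it commutes with `A* A`. -/
def IsQuasiNormal (A : H →L[ℂ] H) : Prop :=
  Commute A (A.adjoint * A)

/-- `T` is Harnack dominated by `T'`: there is a constant `c ≥ 1` such that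
`Re p(T) ≤ c Re p(T')` (in the order of self-adjoint operators) for every polynomial `p` with
`Re p ≥ 0` on the closed unit disc. -/
def HarnackDominated (T T' : H →L[ℂ] H) : Prop :=
  ∃ c : ℝ, 1 ≤ c ∧ ∀ p : Polynomial ℂ, (∀ z : ℂ, ‖z‖ ≤ 1 → 0 ≤ (p.eval z).re) →
    (ℜ (Polynomial.aeval T p) : H →L[ℂ] H) ≤ c • (ℜ (Polynomial.aeval T' p) : H →L[ℂ] H)

/-- `T` and `T'` Harnack dominate each other. -/
def HarnackEquivalent (T T' : H →L[ℂ] H) : Prop :=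
  HarnackDominated T T' ∧ HarnackDominated T' T

/-- The defect operator `D_A = (I - A* A)^{1/2}`. -/
def defectOp (A : H₁ →L[ℂ] H₂) : H₁ →L[ℂ] H₁ :=
  CFC.sqrt (1 - A.adjoint ∘L A)

/-- The defect space: the closure of the range of the defect operator. -/
def defectSpace (A : H₁ →L[ℂ] H₂) : Submodule ℂ H₁ :=
  (defectOp A).range.topologicalClosure

/-- The defect operator viewed as an operator from `H₁` into the defect space. -/
def defectMap (A : H₁ →L[ℂ] H₂) : H₁ →L[ℂ] defectSpace A :=
  (defectOp A).codRestrict (defectSpace A)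
    fun x => Submodule.le_topologicalClosure _ ⟨x, rfl⟩

/-- The defect operator viewed as an operator from the defect space into `H₁`. -/
def defectRestr (A : H₁ →L[ℂ] H₂) : defectSpace A →L[ℂ] H₁ :=
  defectOp A ∘L (defectSpace A).subtypeL

/-- `B` is Shmul'yan dominated by `A`: `B = A + D_{A*} X D_A` for some bounded operator `X` from
the defect space of `A` to the defect space of `A*`. -/
def ShmulyanDominated (B A : H₁ →L[ℂ] H₂) : Prop :=
  ∃ X : defectSpace A →L[ℂ] defectSpace A.adjoint,
    B = A + defectRestr A.adjoint ∘L X ∘L defectMap A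

/-- `A` and `B` Shmul'yan dominate each other. -/
def ShmulyanEquivalent (A B : H₁ →L[ℂ] H₂) : Prop :=
  ShmulyanDominated A B ∧ ShmulyanDominated B A

/-- The space `ℓ²_ℕ(E)` of square summable sequences in `E`. -/
abbrev SeqSpace (E : Type*) [NormedAddCommGroup E] : Type _ := lp (fun _ : ℕ => E) 2

/-- The sequence `(0, f 0, f 1, …)`. -/
def shiftFun {E : Type*} [NormedAddCommGroup E] (f : ℕ → E) : ℕ → E
  | 0 => 0
  | n + 1 => f n

theorem hasSum_shiftFun {E : Type*} [NormedAddCommGroup E] (f : SeqSpace E) :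
    HasSum (fun n => ‖shiftFun f n‖ ^ (2 : ℝ≥0∞).toReal) (‖f‖ ^ (2 : ℝ≥0∞).toReal) := by
  have h := lp.hasSum_norm (p := 2) (by norm_num) f
  rw [← hasSum_nat_add_iff' 1]
  simpa [shiftFun] using h

theorem memℓp_shiftFun {E : Type*} [NormedAddCommGroup E] (f : SeqSpace E) : Memℓp (shiftFun f) 2 :=
  memℓp_gen (hasSum_shiftFun f).summable

/-- The forward shift `(f 0, f 1, …) ↦ (0, f 0, f 1, …)` on `ℓ²_ℕ(E)`. -/
def shift (E : Type*) [NormedAddCommGroup E] [InnerProductSpace ℂ E] :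
    SeqSpace E →L[ℂ] SeqSpace E :=
  LinearMap.mkContinuous
    { toFun := fun f => ⟨shiftFun f, memℓp_shiftFun f⟩
      map_add' := fun f g => by
        ext n
        cases n with
        | zero => exact (add_zero (0 : E)).symm
        | succ n => rfl
      map_smul' := fun a f => by
        ext n
        cases n <;> simp [shiftFun] }
    1 fun f => by
      have h := lp.hasSum_norm (p := 2) (by norm_num)
        (⟨shiftFun f, memℓp_shiftFun f⟩ : SeqSpace E)
      have h' := h.unique (hasSum_shiftFun f)
      rw [one_mul]
      exact le_of_eq ((Real.rpow_left_inj (norm_nonneg _) (norm_nonneg _) (by norm_num)).1 h')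

/-- The canonical inclusion `x ↦ (x, 0, 0, …)` of `E` into `ℓ²_ℕ(E)`. -/
def inclZero (E : Type*) [NormedAddCommGroup E] [InnerProductSpace ℂ E] : E →L[ℂ] SeqSpace E :=
  lp.singleContinuousLinearMap ℂ (fun _ : ℕ => E) 2 0

end

end HarnackShmulyan

/-! Harnack domination is an inequality between the quadratic forms of `Re p(T)` and `Re p(T')`.
Applied to Cesàro sums of Dirichlet kernels and averaged over roots of unity, it compares the
Toeplitz forms of `T` and `T'`, that is, squared norms in their isometric dilations. Since the form
of `T'` collapses to `∑ ‖D_{T'} gₖ‖²` on sequences `(-T' g₀, g₀ - T' g₁, g₁ - T' g₂, …)`, we get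
`‖∑ Tᵏ (T - T') gₖ‖² ≤ c ∑ ‖D_{T'} gₖ‖²`, which is exactly the boundedness of `B`.

Given `B`, the coordinates of `B* h` are `B₀* T*ⁿ h`, where `B₀` is the zeroth coordinate of `B`.
By the commutation hypotheses `B₀*`, seen as an operator `E` on `H`, commutes with `T*` and with
`D_{T*}`, so `∑ ‖T*ⁿ E y‖² ≤ ‖B‖² ‖y‖²`. Replacing `y` by `D_{T*} y`, the sum telescopes to
`‖E y‖²`, whence `‖E y‖ ≤ ‖B‖ ‖D_{T*} y‖`. This bounds `⟪y, (T - T') x⟫` by a multiple of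
`‖D_{T*} y‖ ‖D_{T'} x‖`, a mixed estimate which is enough for Shmul'yan equivalence.

If `T` and `T'` are Shmul'yan equivalent, `T + z (T' - T)` is still a contraction for `z` near `0`
and near `1`, hence by convexity near the segment `[0, 1]`; an analytic disc through `0` and `1`
inside that neighbourhood gives `F`. Finally `F` gives Harnack equivalence by applying Harnack's
inequality to the harmonic functions `Re ⟪x, p(F z) x⟫`, nonnegative by von Neumann's inequality.
-/

namespace HarnackShmulyan

theorem norm_le_of_forall_norm_inner_le {𝕜 E : Type*} [RCLike 𝕜] [NormedAddCommGroup E]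
    [InnerProductSpace 𝕜 E] {x : E} {C : ℝ} (hC : 0 ≤ C) (h : ∀ y, ‖⟪x, y⟫_𝕜‖ ≤ C * ‖y‖) :
    ‖x‖ ≤ C :=
  innerSL_apply_norm 𝕜 x ▸ ContinuousLinearMap.opNorm_le_bound _ hC h

section Defect

variable {H₁ H₂ H₃ H₄ : Type*}
  [NormedAddCommGroup H₁] [InnerProductSpace ℂ H₁] [CompleteSpace H₁]
  [NormedAddCommGroup H₂] [InnerProductSpace ℂ H₂] [CompleteSpace H₂]
  [NormedAddCommGroup H₃] [InnerProductSpace ℂ H₃] [CompleteSpace H₃]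
  [NormedAddCommGroup H₄] [InnerProductSpace ℂ H₄] [CompleteSpace H₄]

instance completeSpace_defectSpace (A : H₁ →L[ℂ] H₂) : CompleteSpace (defectSpace A) :=
  inferInstanceAs (CompleteSpace (defectOp A).range.topologicalClosure)

theorem norm_adjoint_le_one {A : H₁ →L[ℂ] H₂} (hA : ‖A‖ ≤ 1) : ‖A.adjoint‖ ≤ 1 := by
  rwa [LinearIsometryEquiv.norm_map]

theorem one_sub_adjoint_comp_nonneg {A : H₁ →L[ℂ] H₂} (hA : ‖A‖ ≤ 1) :
    0 ≤ 1 - A.adjoint ∘L A := by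
  have norm_le_one : ‖A.adjoint ∘L A‖ ≤ 1 := by
    rw [ContinuousLinearMap.norm_adjoint_comp_self]
    exact mul_le_one₀ hA (norm_nonneg _) hA
  exact sub_nonneg.2 ((CStarAlgebra.norm_le_one_iff_of_nonneg _
    ((ContinuousLinearMap.nonneg_iff_isPositive _).2 A.isPositive_adjoint_comp_self)).1 norm_le_one)

theorem isSelfAdjoint_defectOp (A : H₁ →L[ℂ] H₂) : IsSelfAdjoint (defectOp A) :=
  (CFC.sqrt_nonneg _).isSelfAdjoint

theorem inner_defectOp_left (A : H₁ →L[ℂ] H₂) (x y : H₁) :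
    ⟪defectOp A x, y⟫_ℂ = ⟪x, defectOp A y⟫_ℂ :=
  (isSelfAdjoint_defectOp A).isSymmetric x y

theorem defectOp_apply_defectOp {A : H₁ →L[ℂ] H₂} (hA : ‖A‖ ≤ 1) (x : H₁) :
    defectOp A (defectOp A x) = x - A.adjoint (A x) :=
  congr($(CFC.sqrt_mul_sqrt_self _ (one_sub_adjoint_comp_nonneg hA)) x)

theorem norm_defectOp_sq {A : H₁ →L[ℂ] H₂} (hA : ‖A‖ ≤ 1) (x : H₁) :
    ‖defectOp A x‖ ^ 2 = ‖x‖ ^ 2 - ‖A x‖ ^ 2 := by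
  rw [← inner_self_eq_norm_sq (𝕜 := ℂ), inner_defectOp_left, defectOp_apply_defectOp hA,
    inner_sub_right, ContinuousLinearMap.adjoint_inner_right, map_sub, inner_self_eq_norm_sq,
    inner_self_eq_norm_sq]

theorem norm_defectOp_le {A : H₁ →L[ℂ] H₂} (hA : ‖A‖ ≤ 1) (x : H₁) : ‖defectOp A x‖ ≤ ‖x‖ := by
  refine le_of_sq_le_sq ?_ (norm_nonneg _)
  rw [norm_defectOp_sq hA]
  linarith [sq_nonneg ‖A x‖]

theorem norm_defectOp_adjoint_apply_le {A : H₁ →L[ℂ] H₂} (hA : ‖A‖ ≤ 1) (x : H₁) :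
    ‖defectOp A.adjoint (A x)‖ ≤ ‖defectOp A x‖ := by
  have norm_apply_sq_le : ‖A x‖ ^ 2 ≤ ‖A.adjoint (A x)‖ * ‖x‖ := by
    rw [← inner_self_eq_norm_sq (𝕜 := ℂ), ← ContinuousLinearMap.adjoint_inner_left]
    exact re_inner_le_norm _ _
  refine le_of_sq_le_sq ?_ (norm_nonneg _)
  rw [norm_defectOp_sq hA, norm_defectOp_sq (norm_adjoint_le_one hA)]
  linarith [two_mul_le_add_sq ‖A.adjoint (A x)‖ ‖x‖]

theorem norm_defectMap (A : H₁ →L[ℂ] H₂) (x : H₁) : ‖defectMap A x‖ = ‖defectOp A x‖ := rfl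

theorem inner_defectMap_right (A : H₁ →L[ℂ] H₂) (v : defectSpace A) (x : H₁) :
    ⟪v, defectMap A x⟫_ℂ = ⟪defectRestr A v, x⟫_ℂ :=
  (inner_defectOp_left A v x).symm

theorem adjoint_defectMap (A : H₁ →L[ℂ] H₂) : (defectMap A).adjoint = defectRestr A :=
  ((ContinuousLinearMap.eq_adjoint_iff _ _).2 fun v x => (inner_defectMap_right A v x).symm).symm

theorem denseRange_defectMap (A : H₁ →L[ℂ] H₂) : DenseRange (defectMap A) := by
  rintro ⟨x, hx⟩
  rw [Metric.mem_closure_range_iff]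
  intro ε hε
  obtain ⟨_, ⟨y, rfl⟩, hy⟩ := Metric.mem_closure_iff.1 hx ε hε
  exact ⟨y, hy⟩

theorem injOn_defectOp (A : H₁ →L[ℂ] H₂) : Set.InjOn (defectOp A) (defectSpace A) := by
  intro x hx y hy hxy
  have mk_sub_eq_zero : (⟨x - y, Submodule.sub_mem _ hx hy⟩ : defectSpace A) = 0 := by
    refine (denseRange_defectMap A).eq_zero_of_inner_left ℂ fun z => ?_
    rw [inner_defectMap_right]
    change ⟪defectOp A (x - y), z⟫_ℂ = 0
    rw [map_sub, hxy, sub_self, inner_zero_left]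
  exact sub_eq_zero.1 (congrArg Subtype.val mk_sub_eq_zero)

/-- Douglas' lemma for the factor `D_A`. -/
theorem exists_comp_defectMap_eq (A : H₁ →L[ℂ] H₂) (R : H₁ →L[ℂ] H₃) {C : ℝ}
    (hR : ∀ x, ‖R x‖ ≤ C * ‖defectOp A x‖) :
    ∃ W : defectSpace A →L[ℂ] H₃, W ∘L defectMap A = R := by
  refine ⟨(R : H₁ →ₗ[ℂ] H₃).extendOfNorm (defectMap A : H₁ →ₗ[ℂ] defectSpace A), ?_⟩
  ext x
  exact LinearMap.extendOfNorm_eq (denseRange_defectMap A) ⟨C, hR⟩ x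

theorem exists_defectRestr_comp_comp_defectMap_eq (A : H₁ →L[ℂ] H₂) (B : H₃ →L[ℂ] H₄)
    (R : H₃ →L[ℂ] H₁) {C : ℝ} (hC : 0 ≤ C)
    (hR : ∀ x y, ‖⟪y, R x⟫_ℂ‖ ≤ C * ‖defectOp A y‖ * ‖defectOp B x‖) :
    ∃ X : defectSpace B →L[ℂ] defectSpace A, defectRestr A ∘L X ∘L defectMap B = R := by
  have norm_R_le : ∀ x, ‖R x‖ ≤ C * ‖defectOp A‖ * ‖defectOp B x‖ := fun x => by
    refine norm_le_of_forall_norm_inner_le (𝕜 := ℂ) (by positivity) fun y => ?_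
    rw [norm_inner_symm]
    calc ‖⟪y, R x⟫_ℂ‖ ≤ C * ‖defectOp A y‖ * ‖defectOp B x‖ := hR x y
      _ ≤ C * (‖defectOp A‖ * ‖y‖) * ‖defectOp B x‖ := by gcongr; exact (defectOp A).le_opNorm y
      _ = _ := by ring
  obtain ⟨W, rfl⟩ := exists_comp_defectMap_eq B R norm_R_le
  have norm_adjoint_W_le : ∀ y, ‖W.adjoint y‖ ≤ C * ‖defectOp A y‖ := fun y => by
    refine norm_le_of_forall_norm_inner_le (𝕜 := ℂ) (by positivity) fun v => ?_
    refine (denseRange_defectMap B).induction_on v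
      (isClosed_le (by fun_prop) (by fun_prop)) fun x => ?_
    rw [ContinuousLinearMap.adjoint_inner_left]
    exact hR x y
  obtain ⟨V, hV⟩ := exists_comp_defectMap_eq A W.adjoint norm_adjoint_W_le
  refine ⟨V.adjoint, ?_⟩
  rw [← ContinuousLinearMap.comp_assoc, ← adjoint_defectMap, ← ContinuousLinearMap.adjoint_comp,
    hV, ContinuousLinearMap.adjoint_adjoint]

theorem commute_defectOp {A : H₁ →L[ℂ] H₂} {S : H₁ →L[ℂ] H₁}
    (h : Commute S (A.adjoint ∘L A)) : Commute S (defectOp A) :=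
  (((Commute.one_left S).sub_left h.symm).cfcₙ_nnreal _).symm

theorem commute_adjoint_defectOp {A : H₁ →L[ℂ] H₂} {S : H₁ →L[ℂ] H₁}
    (h : Commute S (defectOp A)) : Commute S.adjoint (defectOp A) :=
  (isSelfAdjoint_defectOp A).star_eq ▸ h.star_star

theorem apply_mem_defectSpace {A : H₁ →L[ℂ] H₂} {S : H₁ →L[ℂ] H₁} (h : Commute S (defectOp A))
    {x : H₁} (hx : x ∈ defectSpace A) : S x ∈ defectSpace A := by
  have mapsTo : Set.MapsTo S (Set.range (defectOp A)) (Set.range (defectOp A)) := by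
    rintro _ ⟨y, rfl⟩
    exact ⟨S y, congr($(h.eq.symm) y)⟩
  exact mapsTo.closure S.continuous hx

theorem commute_of_commute_defectOp_mul {A : H₁ →L[ℂ] H₂} {S E : H₁ →L[ℂ] H₁}
    (hE : ∀ x, E x ∈ defectSpace A) (hS : Commute S (defectOp A))
    (hSE : Commute S (defectOp A * E)) : Commute S E := by
  ext x
  refine injOn_defectOp A (apply_mem_defectSpace hS (hE x)) (hE (S x)) ?_
  exact congr($(show defectOp A * (S * E) = defectOp A * (E * S) by
    rw [← mul_assoc, ← hS.eq, mul_assoc, hSE.eq, mul_assoc]) x)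

end Defect

section Shmulyan

variable {H₁ H₂ : Type*}
  [NormedAddCommGroup H₁] [InnerProductSpace ℂ H₁] [CompleteSpace H₁]
  [NormedAddCommGroup H₂] [InnerProductSpace ℂ H₂] [CompleteSpace H₂]

theorem shmulyanDominated_iff {A B : H₁ →L[ℂ] H₂} :
    ShmulyanDominated B A ↔ ∃ C : ℝ, 0 ≤ C ∧
      ∀ x y, ‖⟪y, (B - A) x⟫_ℂ‖ ≤ C * ‖defectOp A.adjoint y‖ * ‖defectOp A x‖ := by
  constructor
  · rintro ⟨X, rfl⟩
    refine ⟨‖X‖, norm_nonneg X, fun x y => ?_⟩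
    rw [add_sub_cancel_left]
    calc ‖⟪y, defectOp A.adjoint (X (defectMap A x))⟫_ℂ‖
        = ‖⟪defectOp A.adjoint y, (X (defectMap A x) : H₂)⟫_ℂ‖ := by rw [inner_defectOp_left]
      _ ≤ ‖defectOp A.adjoint y‖ * ‖X (defectMap A x)‖ := norm_inner_le_norm _ _
      _ ≤ ‖defectOp A.adjoint y‖ * (‖X‖ * ‖defectOp A x‖) := by gcongr; exact X.le_opNorm _
      _ = _ := by ring
  · rintro ⟨C, hC, bound⟩
    obtain ⟨X, hX⟩ := exists_defectRestr_comp_comp_defectMap_eq A.adjoint A (B - A) hC bound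
    exact ⟨X, eq_add_of_sub_eq' hX.symm⟩

theorem le_one_add_two_mul_mul_of_sq_sub_sq_le {a b C : ℝ} (hb : 0 ≤ b) (hC : 0 ≤ C)
    (h : a ^ 2 - b ^ 2 ≤ 2 * (C * b * a)) : a ≤ (1 + 2 * C) * b := by
  by_contra! hlt
  have hba : b ≤ a := by nlinarith [mul_nonneg hC hb]
  nlinarith [mul_nonneg hC hb, mul_le_mul_of_nonneg_left hba hb]

theorem norm_defectOp_le_of_norm_inner_sub_le {A B : H₁ →L[ℂ] H₂} (hA : ‖A‖ ≤ 1) (hB : ‖B‖ ≤ 1)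
    {C : ℝ} (hC : 0 ≤ C)
    (bound : ∀ x y, ‖⟪y, (A - B) x⟫_ℂ‖ ≤ C * ‖defectOp A.adjoint y‖ * ‖defectOp B x‖) (x : H₁) :
    ‖defectOp B x‖ ≤ (1 + 2 * C) * ‖defectOp A x‖ := by
  refine le_one_add_two_mul_mul_of_sq_sub_sq_le (norm_nonneg _) hC ?_
  have norm_B_sq := norm_sub_sq (𝕜 := ℂ) (A x) ((A - B) x)
  rw [sub_apply, sub_sub_cancel, ← sub_apply] at norm_B_sq
  have re_inner_le : RCLike.re ⟪A x, (A - B) x⟫_ℂ ≤ C * ‖defectOp A x‖ * ‖defectOp B x‖ :=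
    calc RCLike.re ⟪A x, (A - B) x⟫_ℂ
        ≤ C * ‖defectOp A.adjoint (A x)‖ * ‖defectOp B x‖ :=
          (RCLike.re_le_norm _).trans (bound x (A x))
      _ ≤ C * ‖defectOp A x‖ * ‖defectOp B x‖ := by
          gcongr
          exact norm_defectOp_adjoint_apply_le hA x
  rw [norm_defectOp_sq hA, norm_defectOp_sq hB]
  linarith [sq_nonneg ‖(A - B) x‖]

/-- The mixed factorization `A - B = D_{A*} X D_B` already gives Shmul'yan equivalence, because it
makes both pairs of defect operators comparable. -/
theorem shmulyanEquivalent_of_norm_inner_sub_le {A B : H₁ →L[ℂ] H₂} (hA : ‖A‖ ≤ 1) (hB : ‖B‖ ≤ 1)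
    {C : ℝ} (hC : 0 ≤ C)
    (bound : ∀ x y, ‖⟪y, (A - B) x⟫_ℂ‖ ≤ C * ‖defectOp A.adjoint y‖ * ‖defectOp B x‖) :
    ShmulyanEquivalent A B := by
  have defectOp_le := norm_defectOp_le_of_norm_inner_sub_le hA hB hC bound
  have defectOp_adjoint_le : ∀ y,
      ‖defectOp A.adjoint y‖ ≤ (1 + 2 * C) * ‖defectOp B.adjoint y‖ := by
    refine norm_defectOp_le_of_norm_inner_sub_le (norm_adjoint_le_one hB) (norm_adjoint_le_one hA)
      hC fun y x => ?_
    rw [ContinuousLinearMap.adjoint_adjoint, ← map_sub, ContinuousLinearMap.adjoint_inner_right,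
      norm_inner_symm, ← neg_sub A B, neg_apply, inner_neg_right, norm_neg]
    exact (bound x y).trans_eq (by ring)
  refine ⟨shmulyanDominated_iff.2 ⟨C * (1 + 2 * C), by positivity, fun x y => ?_⟩,
    shmulyanDominated_iff.2 ⟨C * (1 + 2 * C), by positivity, fun x y => ?_⟩⟩
  · calc ‖⟪y, (A - B) x⟫_ℂ‖ ≤ C * ‖defectOp A.adjoint y‖ * ‖defectOp B x‖ := bound x y
      _ ≤ C * ((1 + 2 * C) * ‖defectOp B.adjoint y‖) * ‖defectOp B x‖ := by
          gcongr
          exact defectOp_adjoint_le y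
      _ = _ := by ring
  · calc ‖⟪y, (B - A) x⟫_ℂ‖ = ‖⟪y, (A - B) x⟫_ℂ‖ := by
          rw [← neg_sub A B, neg_apply, inner_neg_right, norm_neg]
      _ ≤ C * ‖defectOp A.adjoint y‖ * ‖defectOp B x‖ := bound x y
      _ ≤ C * ‖defectOp A.adjoint y‖ * ((1 + 2 * C) * ‖defectOp A x‖) := by
          gcongr
          exact defectOp_le x
      _ = _ := by ring

theorem norm_apply_add_le_norm_iff {A : H₁ →L[ℂ] H₂} (hA : ‖A‖ ≤ 1) (x : H₁) (v : H₂) :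
    ‖A x + v‖ ≤ ‖x‖ ↔ 2 * RCLike.re ⟪A x, v⟫_ℂ + ‖v‖ ^ 2 ≤ ‖defectOp A x‖ ^ 2 := by
  rw [← sq_le_sq₀ (norm_nonneg _) (norm_nonneg _), norm_add_sq (𝕜 := ℂ), norm_defectOp_sq hA,
    le_sub_iff_add_le', add_assoc]

theorem ShmulyanDominated.exists_norm_add_smul_sub_le_one {A B : H₁ →L[ℂ] H₂} (hA : ‖A‖ ≤ 1)
    (h : ShmulyanDominated B A) :
    ∃ r : ℝ, 0 < r ∧ ∀ l ∈ Metric.ball (0 : ℂ) r, ‖A + l • (B - A)‖ ≤ 1 := by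
  obtain ⟨C, hC, bound⟩ := shmulyanDominated_iff.1 h
  refine ⟨1 / (3 * (C + 1)), by positivity, fun l hl => ?_⟩
  have norm_l_mul_le : ‖l‖ * C ≤ 1 / 3 := by
    rw [mem_ball_zero_iff, lt_div_iff₀ (by positivity)] at hl
    linarith [norm_nonneg l]
  refine ContinuousLinearMap.opNorm_le_bound _ zero_le_one fun x => ?_
  have norm_inner_le : ∀ y, ‖⟪y, l • (B - A) x⟫_ℂ‖ ≤
      1 / 3 * ‖defectOp A.adjoint y‖ * ‖defectOp A x‖ := fun y =>
    calc ‖⟪y, l • (B - A) x⟫_ℂ‖ = ‖l‖ * ‖⟪y, (B - A) x⟫_ℂ‖ := by rw [inner_smul_right, norm_mul]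
      _ ≤ ‖l‖ * (C * ‖defectOp A.adjoint y‖ * ‖defectOp A x‖) := by gcongr; exact bound x y
      _ = ‖l‖ * C * ‖defectOp A.adjoint y‖ * ‖defectOp A x‖ := by ring
      _ ≤ 1 / 3 * ‖defectOp A.adjoint y‖ * ‖defectOp A x‖ := by gcongr
  have norm_le : ‖l • (B - A) x‖ ≤ 1 / 3 * ‖defectOp A x‖ := by
    refine norm_le_of_forall_norm_inner_le (𝕜 := ℂ) (by positivity) fun y => ?_
    rw [norm_inner_symm, mul_right_comm]
    refine (norm_inner_le y).trans ?_
    gcongr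
    exact norm_defectOp_le (norm_adjoint_le_one hA) y
  have re_inner_le : RCLike.re ⟪A x, l • (B - A) x⟫_ℂ ≤ 1 / 3 * ‖defectOp A x‖ ^ 2 := by
    rw [sq, ← mul_assoc]
    refine (RCLike.re_le_norm _).trans ((norm_inner_le (A x)).trans ?_)
    gcongr
    exact norm_defectOp_adjoint_apply_le hA x
  rw [one_mul]
  refine (norm_apply_add_le_norm_iff hA x (l • (B - A) x)).2 ?_
  nlinarith [pow_le_pow_left₀ (norm_nonneg _) norm_le 2]

end Shmulyan

section Arc

theorem thickening_segment_subset_of_convex {E : Type*} [SeminormedAddCommGroup E] [NormedSpace ℝ E]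
    {s : Set E} (hs : Convex ℝ s) {a b : E} {r : ℝ} (ha : Metric.ball a r ⊆ s)
    (hb : Metric.ball b r ⊆ s) : Metric.thickening r (segment ℝ a b) ⊆ s := by
  rw [← convexHull_pair, ← add_ball_zero, ← (convex_ball (0 : E) r).convexHull_eq,
    ← convexHull_add]
  refine convexHull_min ?_ hs
  rw [add_ball_zero, Metric.thickening_eq_biUnion_ball, Set.biUnion_pair]
  exact Set.union_subset ha hb

theorem mem_thickening_segment_zero_one {w : ℂ} {r : ℝ} (hre₀ : -(r / 2) ≤ w.re)
    (hre₁ : w.re ≤ 1 + r / 2) (him : |w.im| < r / 2) :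
    w ∈ Metric.thickening r (segment ℝ (0 : ℂ) 1) := by
  have hr : 0 < r := by linarith [abs_nonneg w.im]
  set t : ℝ := max 0 (min 1 w.re)
  have abs_re_sub_le : |w.re - t| ≤ r / 2 := by grind
  have t_mem : (t : ℂ) ∈ segment ℝ (0 : ℂ) 1 :=
    ⟨1 - t, t, by grind, by grind, by ring, by simp⟩
  refine Metric.mem_thickening_iff.2 ⟨t, t_mem, ?_⟩
  calc dist w t ≤ |w.re - t| + |w.im| := by
        simpa [dist_eq_norm] using Complex.norm_le_abs_re_add_abs_im (w - t)
    _ < r := by linarith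

theorem neg_mul_log_mem_thickening_segment {u : ℂ} {r : ℝ} (hr : 0 < r) (hu : ‖u‖ ≤ 2)
    (hre : Real.exp (-(4 / r + 2)) < u.re) :
    -(r / 4 : ℝ) * Complex.log u ∈ Metric.thickening r (segment ℝ (0 : ℂ) 1) := by
  have re_pos : 0 < u.re := (Real.exp_pos _).trans hre
  have exp_lt_norm : Real.exp (-(4 / r + 2)) < ‖u‖ := hre.trans_le (Complex.re_le_norm u)
  have le_log_norm : -(4 / r + 2) ≤ Real.log ‖u‖ :=
    (Real.le_log_iff_exp_le ((Real.exp_pos _).trans exp_lt_norm)).2 exp_lt_norm.le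
  have log_norm_le : Real.log ‖u‖ ≤ 1 := by
    linarith [Real.log_le_sub_one_of_pos ((Real.exp_pos _).trans exp_lt_norm)]
  have abs_arg_lt : |u.arg| < 2 := by
    linarith [Complex.abs_arg_le_pi_div_two_iff.2 re_pos.le, Real.pi_lt_four]
  rw [← Complex.ofReal_neg]
  refine mem_thickening_segment_zero_one ?_ ?_ ?_
  · rw [Complex.re_ofReal_mul, Complex.log_re]
    nlinarith
  · rw [Complex.re_ofReal_mul, Complex.log_re]
    calc -(r / 4) * Real.log ‖u‖ = r / 4 * -Real.log ‖u‖ := by ring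
      _ ≤ r / 4 * (4 / r + 2) := by gcongr; linarith
      _ = 1 + r / 2 := by field_simp; ring
  · rw [Complex.im_ofReal_mul, Complex.log_im, abs_mul, abs_neg, abs_of_pos (by positivity)]
    nlinarith

/-- The map `z ↦ -(r/4) log (1 - (1 - b) z)` with `b` small sends the disc into a long thin
neighbourhood of the segment. -/
theorem exists_analytic_disc_thickening_segment {r : ℝ} (hr : 0 < r) :
    ∃ z₀ ∈ Metric.ball (0 : ℂ) 1, ∃ φ : ℂ → ℂ, AnalyticOnNhd ℂ φ (Metric.ball 0 1) ∧
      φ 0 = 0 ∧ φ z₀ = 1 ∧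
      Set.MapsTo φ (Metric.ball 0 1) (Metric.thickening r (segment ℝ 0 1)) := by
  set a : ℝ := Real.exp (-(4 / r))
  set b : ℝ := Real.exp (-(4 / r + 2))
  have a_lt_one : a < 1 := Real.exp_lt_one_iff.2 (neg_neg_of_pos (by positivity))
  have b_pos : 0 < b := Real.exp_pos _
  have b_lt_a : b < a := Real.exp_lt_exp.2 (by linarith)
  have re_lt : ∀ z ∈ Metric.ball (0 : ℂ) 1, b < (1 - (1 - b : ℝ) * z).re := by
    intro z hz
    have : z.re < 1 := (Complex.re_le_norm z).trans_lt (mem_ball_zero_iff.1 hz)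
    rw [Complex.sub_re, Complex.one_re, Complex.re_ofReal_mul]
    nlinarith
  have norm_le : ∀ z ∈ Metric.ball (0 : ℂ) 1, ‖1 - (1 - b : ℝ) * z‖ ≤ 2 := by
    intro z hz
    have : ‖z‖ < 1 := mem_ball_zero_iff.1 hz
    refine (norm_sub_le _ _).trans ?_
    rw [norm_one, norm_mul, Complex.norm_real, Real.norm_of_nonneg (by linarith)]
    nlinarith [norm_nonneg z]
  refine ⟨((1 - a) / (1 - b) : ℝ), ?_, fun z => -(r / 4 : ℝ) * Complex.log (1 - (1 - b : ℝ) * z),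
    fun z hz => ?_, by simp, ?_,
    fun z hz => neg_mul_log_mem_thickening_segment hr (norm_le z hz) (re_lt z hz)⟩
  · rw [mem_ball_zero_iff, Complex.norm_real, Real.norm_of_nonneg (by
      apply div_nonneg <;> linarith), div_lt_one (by linarith)]
    linarith
  · exact analyticAt_const.mul
      (AnalyticAt.clog (by fun_prop) (Or.inl (b_pos.trans (re_lt z hz))))
  · beta_reduce
    rw [← Complex.ofReal_mul, mul_div_cancel₀ _ (by linarith), Complex.ofReal_sub,
      Complex.ofReal_one, sub_sub_cancel, ← Complex.ofReal_log (by positivity), Real.log_exp,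
      ← Complex.ofReal_neg, ← Complex.ofReal_mul, Complex.ofReal_eq_one]
    field_simp

theorem ShmulyanEquivalent.exists_analyticOnNhd {H₁ H₂ : Type*}
    [NormedAddCommGroup H₁] [InnerProductSpace ℂ H₁] [CompleteSpace H₁]
    [NormedAddCommGroup H₂] [InnerProductSpace ℂ H₂] [CompleteSpace H₂]
    {A B : H₁ →L[ℂ] H₂} (hA : ‖A‖ ≤ 1) (hB : ‖B‖ ≤ 1) (h : ShmulyanEquivalent A B) :
    ∃ z₀ ∈ Metric.ball (0 : ℂ) 1, ∃ F : ℂ → H₁ →L[ℂ] H₂,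
      AnalyticOnNhd ℂ F (Metric.ball 0 1) ∧ (∀ z ∈ Metric.ball (0 : ℂ) 1, ‖F z‖ ≤ 1) ∧
        F 0 = A ∧ F z₀ = B := by
  obtain ⟨r₀, hr₀, ball_zero⟩ := h.2.exists_norm_add_smul_sub_le_one hA
  obtain ⟨r₁, hr₁, ball_one⟩ := h.1.exists_norm_add_smul_sub_le_one hB
  obtain ⟨z₀, hz₀, φ, hφ, φ_zero, φ_z₀, mapsTo⟩ :=
    exists_analytic_disc_thickening_segment (lt_min hr₀ hr₁)
  have convex : Convex ℝ {l : ℂ | ‖A + l • (B - A)‖ ≤ 1} := by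
    simpa [Set.preimage, dist_eq_norm, add_comm] using (convex_closedBall (-A) 1).linear_preimage
      ((LinearMap.toSpanSingleton ℂ _ (B - A)).restrictScalars ℝ)
  have thickening_subset := thickening_segment_subset_of_convex (a := 0) (b := 1)
    (r := min r₀ r₁) convex (fun l hl => ball_zero l (Metric.ball_subset_ball (min_le_left _ _) hl))
    fun l hl => by
      have norm_le := ball_one (1 - l) (by
        rw [mem_ball_zero_iff, norm_sub_rev, ← mem_ball_iff_norm]
        exact Metric.ball_subset_ball (min_le_right _ _) hl)
      rwa [show B + (1 - l) • (A - B) = A + l • (B - A) by module] at norm_le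
  exact ⟨z₀, hz₀, fun z => A + φ z • (B - A),
    fun z hz => analyticAt_const.add ((hφ z hz).smul analyticAt_const),
    fun z hz => thickening_subset (mapsTo hz), by simp [φ_zero], by simp [φ_z₀]⟩

end Arc

section Intertwining

theorem shift_single {E : Type*} [NormedAddCommGroup E] [InnerProductSpace ℂ E] (n : ℕ) (x : E) :
    shift E (lp.single 2 n x) = lp.single 2 (n + 1) x := by
  ext m
  cases m with
  | zero => simp [shift, shiftFun]
  | succ m => simp [shift, shiftFun, Pi.single_apply]

variable {H : Type*} [NormedAddCommGroup H] [InnerProductSpace ℂ H]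

section Coordinates

variable {E : Type*} [NormedAddCommGroup E] [InnerProductSpace ℂ E] {T : H →L[ℂ] H}
  {B : SeqSpace E →L[ℂ] H}

theorem apply_single_of_comp_shift_eq (hB : B ∘L shift E = T ∘L B) (n : ℕ) (x : E) :
    B (lp.single 2 n x) = (T ^ n) (B (inclZero E x)) := by
  induction n with
  | zero => rfl
  | succ n ih =>
    rw [← shift_single, pow_succ', mul_apply_eq_comp, ← ih]
    exact congr($hB (lp.single 2 n x))

theorem adjoint_apply_of_comp_shift_eq [CompleteSpace E] [CompleteSpace H]
    (hB : B ∘L shift E = T ∘L B) (h : H) (n : ℕ) :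
    B.adjoint h n = (B ∘L inclZero E).adjoint ((T.adjoint ^ n) h) := by
  have adjoint_pow : T.adjoint ^ n = (T ^ n).adjoint := (star_pow T n).symm
  refine ext_inner_left ℂ fun x => ?_
  calc ⟪x, B.adjoint h n⟫_ℂ = ⟪lp.single 2 n x, B.adjoint h⟫_ℂ :=
        (lp.inner_single_left (𝕜 := ℂ) n x (B.adjoint h)).symm
    _ = ⟪(T ^ n) (B (inclZero E x)), h⟫_ℂ := by
        rw [ContinuousLinearMap.adjoint_inner_right, apply_single_of_comp_shift_eq hB]
    _ = ⟪B (inclZero E x), (T ^ n).adjoint h⟫_ℂ :=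
        (ContinuousLinearMap.adjoint_inner_right _ _ _).symm
    _ = ⟪x, (B ∘L inclZero E).adjoint ((T.adjoint ^ n) h)⟫_ℂ := by
        rw [adjoint_pow]
        exact (ContinuousLinearMap.adjoint_inner_right (B ∘L inclZero E) _ _).symm

theorem sum_norm_sq_adjoint_le_of_comp_shift_eq [CompleteSpace E] [CompleteSpace H]
    (hB : B ∘L shift E = T ∘L B) (h : H) (N : ℕ) :
    ∑ n ∈ Finset.range N, ‖(B ∘L inclZero E).adjoint ((T.adjoint ^ n) h)‖ ^ 2 ≤
      (‖B‖ * ‖h‖) ^ 2 := by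
  have sum_le := lp.sum_rpow_le_norm_rpow (p := 2) (by norm_num) (B.adjoint h) (Finset.range N)
  simp only [ENNReal.toReal_ofNat, Real.rpow_ofNat, adjoint_apply_of_comp_shift_eq hB] at sum_le
  refine sum_le.trans (pow_le_pow_left₀ (norm_nonneg _) ?_ 2)
  simpa only [LinearIsometryEquiv.norm_map] using B.adjoint.le_opNorm h

end Coordinates

variable [CompleteSpace H]

theorem sum_norm_defectOp_pow_apply_sq {S : H →L[ℂ] H} (hS : ‖S‖ ≤ 1) (x : H) (N : ℕ) :
    ∑ n ∈ Finset.range N, ‖defectOp S ((S ^ n) x)‖ ^ 2 = ‖x‖ ^ 2 - ‖(S ^ N) x‖ ^ 2 := by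
  have pow_succ_apply : ∀ n, (S ^ (n + 1)) x = S ((S ^ n) x) := fun n => congr($(pow_succ' S n) x)
  simp only [norm_defectOp_sq hS, ← pow_succ_apply]
  simpa only [pow_zero, one_apply_eq_self] using Finset.sum_range_sub' (fun n => ‖(S ^ n) x‖ ^ 2) N

theorem norm_apply_le_mul_norm_defectOp {S E : H →L[ℂ] H} (hS : ‖S‖ ≤ 1)
    (hSD : Commute S (defectOp S)) (hED : Commute E (defectOp S)) {C : ℝ} (hC : 0 ≤ C)
    (bound : ∀ x N, ∑ n ∈ Finset.range N, ‖(S ^ n) (E x)‖ ^ 2 ≤ (C * ‖x‖) ^ 2) (x : H) :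
    ‖E x‖ ≤ C * ‖defectOp S x‖ := by
  have pow_apply_comm : ∀ n, defectOp S ((S ^ n) (E x)) = (S ^ n) (E (defectOp S x)) := fun n =>
    congr($(((hSD.pow_left n).mul_left hED).eq.symm) x)
  have norm_sq_sub_le : ∀ N, ‖E x‖ ^ 2 - ‖(S ^ N) (E x)‖ ^ 2 ≤ (C * ‖defectOp S x‖) ^ 2 := by
    intro N
    rw [← sum_norm_defectOp_pow_apply_sq hS]
    simpa only [pow_apply_comm] using bound (defectOp S x) N
  have tendsto_zero :
      Filter.Tendsto (fun n => ‖(S ^ n) (E x)‖ ^ 2) Filter.atTop (nhds 0) :=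
    (summable_of_sum_range_le (fun _ => sq_nonneg _) (bound x)).tendsto_atTop_zero
  refine le_of_sq_le_sq ?_ (by positivity)
  simpa only [sub_zero] using le_of_tendsto' (tendsto_const_nhds.sub tendsto_zero) norm_sq_sub_le

theorem shmulyanEquivalent_of_comp_shift_eq {T T' : H →L[ℂ] H} (hT : ‖T‖ ≤ 1) (hT' : ‖T'‖ ≤ 1)
    (hqn : IsQuasiNormal T.adjoint) (hTT' : Commute T T')
    (hTT'T' : Commute T (T'.adjoint * T')) (hT'TT : Commute T' (T * T.adjoint))
    {B : SeqSpace (defectSpace T') →L[ℂ] H}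
    (hTB : T = T' + B ∘L inclZero (defectSpace T') ∘L defectMap T')
    (hB : B ∘L shift (defectSpace T') = T ∘L B) : ShmulyanEquivalent T T' := by
  set d := defectOp T.adjoint
  set D := defectOp T'
  set B₀ := B ∘L inclZero (defectSpace T')
  set E : H →L[ℂ] H := (defectSpace T').subtypeL ∘L B₀.adjoint
  have hTd : Commute T.adjoint d := commute_defectOp hqn
  have hT'd : Commute T' d := commute_defectOp (by rwa [ContinuousLinearMap.adjoint_adjoint])
  have hT'd_adj : Commute T'.adjoint d := commute_adjoint_defectOp hT'd
  have hTD : Commute T.adjoint D := commute_adjoint_defectOp (commute_defectOp hTT'T')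
  have hdD : Commute d D := commute_defectOp (hT'd_adj.symm.mul_right hT'd.symm)
  have D_mul_E : D * E = T.adjoint - T'.adjoint := by
    rw [← map_sub, sub_eq_of_eq_add' hTB, ← ContinuousLinearMap.comp_assoc,
      ContinuousLinearMap.adjoint_comp, adjoint_defectMap]
    rfl
  have hTE : Commute T.adjoint E := commute_of_commute_defectOp_mul (fun h => (B₀.adjoint h).2) hTD
    (D_mul_E ▸ (Commute.refl _).sub_right hTT'.star_star)
  have hdE : Commute d E := commute_of_commute_defectOp_mul (fun h => (B₀.adjoint h).2) hdD
    (D_mul_E ▸ hTd.symm.sub_right hT'd_adj.symm)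
  have norm_E_le : ∀ y, ‖E y‖ ≤ ‖B‖ * ‖d y‖ :=
    norm_apply_le_mul_norm_defectOp (norm_adjoint_le_one hT) hTd hdE.symm (norm_nonneg B)
      fun y N => by
        have pow_apply_comm : ∀ n, (T.adjoint ^ n) (E y) = E ((T.adjoint ^ n) y) := fun n =>
          congr($((hTE.pow_left n).eq) y)
        simp only [pow_apply_comm]
        exact sum_norm_sq_adjoint_le_of_comp_shift_eq hB y N
  refine shmulyanEquivalent_of_norm_inner_sub_le hT hT' (norm_nonneg B) fun x y => ?_
  calc ‖⟪y, (T - T') x⟫_ℂ‖ = ‖⟪B₀.adjoint y, defectMap T' x⟫_ℂ‖ := by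
        rw [sub_eq_of_eq_add' hTB, ContinuousLinearMap.adjoint_inner_left]
        rfl
    _ ≤ ‖E y‖ * ‖D x‖ := norm_inner_le_norm _ _
    _ ≤ ‖B‖ * ‖d y‖ * ‖D x‖ := by gcongr; exact norm_E_le y

end Intertwining

section RootsOfUnity

open Finset

variable {M : ℕ} [NeZero M]

theorem sum_conj_stdAddChar_pow_mul_pow {k n : ℕ} (hk : k < M) (hn : n < M) :
    ∑ j : ZMod M, star (ZMod.stdAddChar j) ^ k * ZMod.stdAddChar j ^ n =
      if n = k then (M : ℂ) else 0 := by
  have term_eq : ∀ j : ZMod M, star (ZMod.stdAddChar j) ^ k * ZMod.stdAddChar j ^ n =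
      ZMod.stdAddChar (j * ((n : ZMod M) - (k : ZMod M))) := fun j => by
    rw [← starRingEnd_apply, ← AddChar.map_neg_eq_conj, ← AddChar.map_nsmul_eq_pow,
      ← AddChar.map_nsmul_eq_pow, ← AddChar.map_add_eq_mul]
    simp only [nsmul_eq_mul]
    ring_nf
  have cast_sub_eq_zero : (n : ZMod M) - (k : ZMod M) = 0 ↔ n = k := by
    rw [sub_eq_zero, ZMod.natCast_eq_natCast_iff', Nat.mod_eq_of_lt hn, Nat.mod_eq_of_lt hk]
  simp only [term_eq, AddChar.sum_mulShift _ (ZMod.isPrimitive_stdAddChar M), cast_sub_eq_zero,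
    ZMod.card, Nat.cast_ite, Nat.cast_zero]

theorem sum_conj_stdAddChar_pow_smul_sum {E : Type*} [AddCommGroup E] [Module ℂ E] {N k : ℕ}
    (hN : N ≤ M) (hk : k < M) {h : ℕ → E} (hh : ∀ n, N ≤ n → h n = 0) :
    ∑ j : ZMod M, star (ZMod.stdAddChar j) ^ k • ∑ n ∈ range N, ZMod.stdAddChar j ^ n • h n =
      (M : ℂ) • h k := by
  calc ∑ j : ZMod M, star (ZMod.stdAddChar j) ^ k • ∑ n ∈ range N, ZMod.stdAddChar j ^ n • h n =
        ∑ n ∈ range N, (∑ j : ZMod M, star (ZMod.stdAddChar j) ^ k * ZMod.stdAddChar j ^ n) •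
          h n := by
        simp only [smul_sum, sum_smul, mul_smul]
        exact sum_comm
    _ = ∑ n ∈ range N, if n = k then (M : ℂ) • h k else 0 := by
        refine sum_congr rfl fun n hn => ?_
        rw [sum_conj_stdAddChar_pow_mul_pow hk ((mem_range.1 hn).trans_le hN)]
        split_ifs with hnk
        · rw [hnk]
        · rw [zero_smul]
    _ = (M : ℂ) • h k := by
        rw [sum_ite_eq']
        split_ifs with hkN
        · rfl
        · rw [hh k (by simpa using hkN), smul_zero]

theorem sum_eval_stdAddChar_mul_conj_pow {p : Polynomial ℂ} (hp : p.natDegree < M) {k : ℕ}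
    (hk : k < M) :
    ∑ j : ZMod M, p.eval (ZMod.stdAddChar j) * star (ZMod.stdAddChar j) ^ k = M * p.coeff k := by
  rw [← smul_eq_mul (M : ℂ), ← sum_conj_stdAddChar_pow_smul_sum hp hk fun n hn =>
    Polynomial.coeff_eq_zero_of_natDegree_lt hn]
  refine sum_congr rfl fun j _ => ?_
  simp only [Polynomial.eval_eq_sum_range, smul_eq_mul, mul_comm]

end RootsOfUnity

section Fejer

open Finset Polynomial

theorem nonneg_of_sum_range_nonneg {u : ℕ → ℝ} {c : ℝ} (hu : Filter.Tendsto u Filter.atTop (nhds c))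
    (h : ∀ L, 0 ≤ ∑ n ∈ range L, u n) : 0 ≤ c :=
  ge_of_tendsto' hu.cesaro fun L => mul_nonneg (by positivity) (h L)

/-- The analytic polynomial `2 (1 + X + ⋯ + Xⁿ) - 1`, whose real part on the unit circle is the
Dirichlet kernel. -/
noncomputable def dirichletPoly (n : ℕ) : ℂ[X] :=
  2 * ∑ k ∈ range (n + 1), X ^ k - 1

variable {H : Type*} [NormedAddCommGroup H] [InnerProductSpace ℂ H]

theorem inner_aeval_smul_dirichletPoly (T : H →L[ℂ] H) (w : ℂ) (n : ℕ) (x : H) :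
    ⟪x, aeval (w • T) (dirichletPoly n) x⟫_ℂ =
      2 * ∑ k ∈ range (n + 1), w ^ k * ⟪x, (T ^ k) x⟫_ℂ - ⟪x, x⟫_ℂ := by
  simp only [dirichletPoly, two_mul, map_sub, map_add, map_sum, map_pow, aeval_X, map_one,
    sub_apply, add_apply, smul_apply, _root_.sum_apply, one_apply_eq_self, _root_.smul_pow,
    inner_sub_right, inner_add_right, inner_sum, inner_smul_right]

theorem re_inner_aeval_dirichletPoly (T : H →L[ℂ] H) (n : ℕ) (x : H) :
    (⟪x, aeval T (dirichletPoly n) x⟫_ℂ).re =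
      ‖∑ k ∈ range (n + 1), (T ^ k) x‖ ^ 2 - ‖T (∑ k ∈ range n, (T ^ k) x)‖ ^ 2 := by
  have sum_succ : ∑ k ∈ range (n + 1), (T ^ k) x = x + T (∑ k ∈ range n, (T ^ k) x) := by
    simp only [sum_range_succ', pow_succ', map_sum, mul_apply_eq_comp, pow_zero, one_apply_eq_self,
      add_comm x]
  have inner_eq := inner_aeval_smul_dirichletPoly T 1 n x
  simp only [one_smul, one_pow, one_mul, ← inner_sum, sum_succ, inner_add_right] at inner_eq
  rw [inner_eq, sum_succ, norm_add_sq (𝕜 := ℂ), ← inner_self_eq_norm_sq (𝕜 := ℂ) x]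
  simp
  ring

theorem sum_re_inner_aeval_dirichletPoly_nonneg {T : H →L[ℂ] H} (hT : ‖T‖ ≤ 1) (L : ℕ) (x : H) :
    0 ≤ ∑ n ∈ range L, (⟪x, aeval T (dirichletPoly n) x⟫_ℂ).re := by
  have telescope := sum_range_sub (fun n => ‖∑ k ∈ range n, (T ^ k) x‖ ^ 2) L
  calc 0 ≤ ∑ n ∈ range L,
        (‖∑ k ∈ range (n + 1), (T ^ k) x‖ ^ 2 - ‖∑ k ∈ range n, (T ^ k) x‖ ^ 2) := by
        rw [telescope]
        simp
    _ ≤ _ := by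
        refine sum_le_sum fun n _ => ?_
        rw [re_inner_aeval_dirichletPoly]
        gcongr
        exact T.le_of_opNorm_le_of_le hT le_rfl |>.trans_eq (one_mul _)

theorem sum_re_eval_dirichletPoly_nonneg {z : ℂ} (hz : ‖z‖ ≤ 1) (L : ℕ) :
    0 ≤ ∑ n ∈ range L, ((dirichletPoly n).eval z).re := by
  have norm_le : ‖algebraMap ℂ (ℂ →L[ℂ] ℂ) z‖ ≤ 1 := by rwa [norm_algebraMap']
  simpa [aeval_algebraMap_apply] using sum_re_inner_aeval_dirichletPoly_nonneg norm_le L 1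

theorem ofReal_re_inner_aeval_smul_dirichletPoly (T : H →L[ℂ] H) (w : ℂ) (n : ℕ) (x : H) :
    ((⟪x, aeval (w • T) (dirichletPoly n) x⟫_ℂ).re : ℂ) =
      ∑ k ∈ range (n + 1), w ^ k * ⟪x, (T ^ k) x⟫_ℂ +
        ∑ k ∈ range n, star w ^ (k + 1) * ⟪(T ^ (k + 1)) x, x⟫_ℂ := by
  have conj_sum : ∑ k ∈ range n, star w ^ (k + 1) * ⟪(T ^ (k + 1)) x, x⟫_ℂ =
      star (∑ k ∈ range n, w ^ (k + 1) * ⟪x, (T ^ (k + 1)) x⟫_ℂ) := by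
    simp only [← starRingEnd_apply, map_sum, map_mul, map_pow, inner_conj_symm]
  have im_inner_self : (⟪x, x⟫_ℂ).im = 0 := inner_self_im (𝕜 := ℂ) x
  rw [inner_aeval_smul_dirichletPoly, conj_sum, sum_range_succ', pow_zero, pow_zero, one_mul,
    one_apply_eq_self]
  generalize ∑ k ∈ range n, w ^ (k + 1) * ⟪x, (T ^ (k + 1)) x⟫_ℂ = S
  generalize ⟪x, x⟫_ℂ = a at im_inner_self
  apply Complex.ext
  · simp
    ring
  · simp [im_inner_self]

theorem sum_re_eval_mul_re_inner_dirichletPoly (T : H →L[ℂ] H) {p : ℂ[X]} {n M : ℕ} [NeZero M]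
    (hM : p.natDegree + n < M) (x : H) :
    ∑ j : ZMod M, (p.eval (ZMod.stdAddChar j)).re *
        (⟪x, aeval (star (ZMod.stdAddChar j) • T) (dirichletPoly n) x⟫_ℂ).re =
      M * ∑ k ∈ range (n + 1), (p.coeff k * ⟪x, (T ^ k) x⟫_ℂ).re := by
  have coeff_mul_X_pow_succ : ∀ k, (p * X ^ (k + 1)).coeff 0 = 0 := fun k => by
    simp
  have sum_eval_mul_pow : ∀ k ∈ range n,
      ∑ j : ZMod M, p.eval (ZMod.stdAddChar j) * ZMod.stdAddChar j ^ (k + 1) = 0 := fun k hk => by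
    have natDegree_lt : (p * X ^ (k + 1)).natDegree < M :=
      (natDegree_mul_le.trans (by rw [natDegree_X_pow])).trans_lt
        (by have := mem_range.1 hk; omega : p.natDegree + (k + 1) < M)
    simpa [coeff_mul_X_pow_succ] using sum_eval_stdAddChar_mul_conj_pow natDegree_lt (NeZero.pos M)
  have sum_eval_mul_re : ∑ j : ZMod M, p.eval (ZMod.stdAddChar j) *
        ((⟪x, aeval (star (ZMod.stdAddChar j) • T) (dirichletPoly n) x⟫_ℂ).re : ℂ) =
      M * ∑ k ∈ range (n + 1), p.coeff k * ⟪x, (T ^ k) x⟫_ℂ := by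
    simp only [ofReal_re_inner_aeval_smul_dirichletPoly, star_star, mul_add, mul_sum, ← mul_assoc,
      sum_add_distrib]
    rw [sum_comm, sum_comm (t := range n)]
    simp only [← sum_mul]
    rw [sum_eq_zero (s := range n) fun k hk => by rw [sum_eval_mul_pow k hk, zero_mul], add_zero]
    refine sum_congr rfl fun k hk => ?_
    rw [sum_eval_stdAddChar_mul_conj_pow (by omega) (by have := mem_range.1 hk; omega)]
  have re_eq := congrArg Complex.re sum_eval_mul_re
  simpa only [Complex.re_sum, Complex.re_mul_ofReal, ← Complex.ofReal_natCast,
    Complex.re_ofReal_mul] using re_eq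

theorem re_inner_aeval_nonneg {T : H →L[ℂ] H} (hT : ‖T‖ ≤ 1) {p : ℂ[X]}
    (hp : ∀ z : ℂ, ‖z‖ ≤ 1 → 0 ≤ (p.eval z).re) (x : H) :
    0 ≤ (⟪x, aeval T p x⟫_ℂ).re := by
  have inner_aeval : ∀ n, p.natDegree ≤ n → (⟪x, aeval T p x⟫_ℂ).re =
      ∑ k ∈ range (n + 1), (p.coeff k * ⟪x, (T ^ k) x⟫_ℂ).re := fun n hn => by
    simp only [aeval_eq_sum_range' (Nat.lt_succ_of_le hn), _root_.sum_apply, inner_sum,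
      Complex.re_sum, smul_apply, inner_smul_right]
  refine nonneg_of_sum_range_nonneg (tendsto_atTop_of_eventually_const
    (u := fun n => ∑ k ∈ range (n + 1), (p.coeff k * ⟪x, (T ^ k) x⟫_ℂ).re)
    fun n hn => (inner_aeval n hn).symm) fun L => ?_
  set M := p.natDegree + L + 1
  have norm_star_smul_le : ∀ j : ZMod M, ‖star (ZMod.stdAddChar j) • T‖ ≤ 1 := fun j => by
    rwa [norm_smul, norm_star, AddChar.norm_apply, one_mul]
  have sum_nonneg : 0 ≤ ∑ j : ZMod M, (p.eval (ZMod.stdAddChar j)).re * ∑ n ∈ range L,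
      (⟪x, aeval (star (ZMod.stdAddChar j) • T) (dirichletPoly n) x⟫_ℂ).re :=
    Fintype.sum_nonneg fun j => mul_nonneg (hp _ (AddChar.norm_apply _ j).le)
      (sum_re_inner_aeval_dirichletPoly_nonneg (norm_star_smul_le j) L x)
  simp only [mul_sum] at sum_nonneg
  rw [sum_comm, sum_congr rfl fun n hn => sum_re_eval_mul_re_inner_dirichletPoly T
    (by have := mem_range.1 hn; omega) x, ← mul_sum] at sum_nonneg
  exact nonneg_of_mul_nonneg_right sum_nonneg (Nat.cast_pos.2 (NeZero.pos M))

end Fejer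

section Toeplitz

open Finset Polynomial

variable {H : Type*} [NormedAddCommGroup H] [InnerProductSpace ℂ H]

/-- The Toeplitz form of `T` at a sequence `h` supported in `{0, …, N - 1}`, with the powers of `T`
truncated at degree `n`. For `N ≤ n` it is the squared norm of `∑ Vᵏ hₖ`, where `V` is an isometric
dilation of `T`. -/
noncomputable def toeplitzForm (T : H →L[ℂ] H) (N n : ℕ) (h : ℕ → H) : ℝ :=
  ∑ m ∈ range N, (2 * (⟪h m, ∑ k ∈ range (n + 1), (T ^ k) (h (m + k))⟫_ℂ).re - ‖h m‖ ^ 2)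

theorem toeplitzForm_of_eq_add {T : H →L[ℂ] H} {N n : ℕ} (hn : N ≤ n) {h s : ℕ → H}
    (hs : ∀ m, s m = h m + T (s (m + 1))) (hN : ∀ m, N ≤ m → s m = 0) :
    toeplitzForm T N n h = ∑ m ∈ range N, (‖s m‖ ^ 2 - ‖T (s (m + 1))‖ ^ 2) := by
  have sum_pow : ∀ m l, s m = ∑ k ∈ range l, (T ^ k) (h (m + k)) + (T ^ l) (s (m + l)) := by
    intro m l
    induction l with
    | zero => simp
    | succ l ih =>
      rw [ih, hs (m + l), sum_range_succ, map_add, add_assoc, pow_succ, mul_apply_eq_comp,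
        add_assoc]
  refine sum_congr rfl fun m _ => ?_
  have sum_eq : ∑ k ∈ range (n + 1), (T ^ k) (h (m + k)) = s m := by
    rw [sum_pow m (n + 1), hN _ (by omega), map_zero, add_zero]
  have norm_sub := norm_sub_sq (𝕜 := ℂ) (s m) (h m)
  rw [sub_eq_of_eq_add' (hs m), inner_re_symm, RCLike.re_to_complex] at norm_sub
  rw [sum_eq]
  linarith

theorem norm_sum_pow_apply_sq_le_toeplitzForm {T : H →L[ℂ] H} (hT : ‖T‖ ≤ 1) {N n : ℕ} (hn : N ≤ n)
    {h : ℕ → H} (hh : ∀ m, N ≤ m → h m = 0) :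
    ‖∑ k ∈ range N, (T ^ k) (h k)‖ ^ 2 ≤ toeplitzForm T N n h := by
  set s : ℕ → H := fun m => ∑ k ∈ range N, (T ^ k) (h (m + k))
  have hs : ∀ m, s m = h m + T (s (m + 1)) := fun m => by
    have sum_succ : s m = ∑ k ∈ range (N + 1), (T ^ k) (h (m + k)) := by
      rw [sum_range_succ, hh (m + N) (by omega), map_zero, add_zero]
    rw [sum_succ, sum_range_succ', map_sum, add_comm]
    simp only [pow_succ', mul_apply_eq_comp, pow_zero, one_apply_eq_self, add_zero, add_assoc,
      add_comm 1]
  have hN : ∀ m, N ≤ m → s m = 0 := fun m hm =>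
    sum_eq_zero fun k _ => by rw [hh _ (by omega), map_zero]
  have telescope := sum_range_sub' (fun m => ‖s m‖ ^ 2) N
  calc ‖∑ k ∈ range N, (T ^ k) (h k)‖ ^ 2 = ∑ m ∈ range N, (‖s m‖ ^ 2 - ‖s (m + 1)‖ ^ 2) := by
        rw [telescope, hN N le_rfl]
        simp [s]
    _ ≤ ∑ m ∈ range N, (‖s m‖ ^ 2 - ‖T (s (m + 1))‖ ^ 2) := by
        gcongr
        exact T.le_of_opNorm_le_of_le hT le_rfl |>.trans_eq (one_mul _)
    _ = toeplitzForm T N n h := (toeplitzForm_of_eq_add hn hs hN).symm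

theorem toeplitzForm_shiftFun_sub (T : H →L[ℂ] H) {N n : ℕ} (hn : N < n) {g : ℕ → H}
    (hg : ∀ m, N ≤ m → g m = 0) :
    toeplitzForm T (N + 1) n (fun m => shiftFun g m - T (g m)) =
      ∑ m ∈ range N, (‖g m‖ ^ 2 - ‖T (g m)‖ ^ 2) := by
  have shiftFun_eq_zero : ∀ m, N + 1 ≤ m → shiftFun g m = 0 := by
    rintro (_ | m) hm
    · rfl
    · exact hg m (by omega)
  rw [toeplitzForm_of_eq_add (h := fun m => shiftFun g m - T (g m)) hn
      (fun m => (sub_add_cancel (shiftFun g m) _).symm) shiftFun_eq_zero,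
    sum_sub_distrib, sum_range_succ', sum_range_succ, sum_sub_distrib]
  simp [shiftFun, hg N le_rfl]

theorem sum_conj_stdAddChar_pow_mul_inner (S : H →L[ℂ] H) {M N k : ℕ} [NeZero M] (hM : N + k ≤ M)
    {h : ℕ → H} (hh : ∀ m, N ≤ m → h m = 0) :
    ∑ j : ZMod M, star (ZMod.stdAddChar j) ^ k *
        ⟪∑ m ∈ range N, ZMod.stdAddChar j ^ m • h m,
          S (∑ m ∈ range N, ZMod.stdAddChar j ^ m • h m)⟫_ℂ =
      M * ∑ m ∈ range N, ⟪h m, S (h (m + k))⟫_ℂ := by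
  set x : ZMod M → H := fun j => ∑ m ∈ range N, ZMod.stdAddChar j ^ m • h m
  have inner_x_left : ∀ j y, ⟪x j, y⟫_ℂ =
      ∑ m ∈ range N, star (ZMod.stdAddChar j) ^ m * ⟪h m, y⟫_ℂ := fun j y => by
    simp only [x, sum_inner, inner_smul_left, map_pow, starRingEnd_apply]
  calc ∑ j : ZMod M, star (ZMod.stdAddChar j) ^ k * ⟪x j, S (x j)⟫_ℂ =
        ∑ m ∈ range N, ⟪h m, S (∑ j : ZMod M, star (ZMod.stdAddChar j) ^ (m + k) • x j)⟫_ℂ := by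
        simp only [inner_x_left, mul_sum, map_sum, map_smul, inner_sum, inner_smul_right]
        rw [sum_comm]
        exact sum_congr rfl fun m _ => sum_congr rfl fun j _ => by ring
    _ = M * ∑ m ∈ range N, ⟪h m, S (h (m + k))⟫_ℂ := by
        rw [mul_sum]
        refine sum_congr rfl fun m hm => ?_
        rw [sum_conj_stdAddChar_pow_smul_sum (by omega) (by have := mem_range.1 hm; omega) hh,
          map_smul, inner_smul_right]

theorem sum_re_inner_aeval_dirichletPoly_eq_toeplitzForm (T : H →L[ℂ] H) {M N n : ℕ} [NeZero M]
    (hM : N + n ≤ M) {h : ℕ → H} (hh : ∀ m, N ≤ m → h m = 0) :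
    ∑ j : ZMod M, (⟪∑ m ∈ range N, ZMod.stdAddChar j ^ m • h m,
        aeval (star (ZMod.stdAddChar j) • T) (dirichletPoly n)
          (∑ m ∈ range N, ZMod.stdAddChar j ^ m • h m)⟫_ℂ).re = M * toeplitzForm T N n h := by
  have parseval : ∀ k ∈ range (n + 1), _ := fun k hk =>
    sum_conj_stdAddChar_pow_mul_inner (T ^ k) (by have := mem_range.1 hk; omega : N + k ≤ M) hh
  have parseval_zero := parseval 0 (by simp)
  simp only [pow_zero, one_mul, one_apply_eq_self, add_zero] at parseval_zero
  have norm_sq_eq : ∀ m, ‖h m‖ ^ 2 = (⟪h m, h m⟫_ℂ).re := fun m =>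
    (inner_self_eq_norm_sq (𝕜 := ℂ) (h m)).symm
  have re_two_mul : ∀ z : ℂ, (2 * z).re = 2 * z.re := fun z => by simp
  simp only [inner_aeval_smul_dirichletPoly]
  rw [← Complex.re_sum, sum_sub_distrib, ← mul_sum, sum_comm, parseval_zero,
    sum_congr rfl parseval, ← mul_sum, sum_comm, mul_left_comm, ← mul_sub,
    ← Complex.ofReal_natCast, Complex.re_ofReal_mul]
  simp only [toeplitzForm, norm_sq_eq, ← inner_sum, sum_sub_distrib, ← mul_sum, Complex.sub_re,
    Complex.re_sum, re_two_mul]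

theorem toeplitzForm_eq_of_le (T : H →L[ℂ] H) {N n : ℕ} (hn : N ≤ n) {h : ℕ → H}
    (hh : ∀ m, N ≤ m → h m = 0) : toeplitzForm T N n h = toeplitzForm T N N h := by
  refine sum_congr rfl fun m _ => ?_
  rw [sum_subset (range_subset_range.2 (Nat.succ_le_succ hn)) fun k _ hk => ?_]
  rw [hh _ (by simp at hk; omega), map_zero]

/-- Harnack domination of `T` by `T'` with constant `c`, expressed through quadratic forms. -/
def HarnackDominatedWith (c : ℝ) (T T' : H →L[ℂ] H) : Prop :=
  ∀ p : ℂ[X], (∀ z : ℂ, ‖z‖ ≤ 1 → 0 ≤ (p.eval z).re) →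
    ∀ x, (⟪x, aeval T p x⟫_ℂ).re ≤ c * (⟪x, aeval T' p x⟫_ℂ).re

theorem sum_re_inner_aeval_smul_dirichletPoly_le {T T' : H →L[ℂ] H} {c : ℝ}
    (hc : HarnackDominatedWith c T T') {w : ℂ} (hw : ‖w‖ ≤ 1) (L : ℕ) (x : H) :
    ∑ n ∈ range L, (⟪x, aeval (w • T) (dirichletPoly n) x⟫_ℂ).re ≤
      c * ∑ n ∈ range L, (⟪x, aeval (w • T') (dirichletPoly n) x⟫_ℂ).re := by
  have aeval_comp_eq : ∀ (S : H →L[ℂ] H) (p : ℂ[X]), aeval S (p.comp (w • X)) = aeval (w • S) p :=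
    fun S p => by rw [aeval_comp, map_smul, aeval_X]
  have le := hc (∑ n ∈ range L, (dirichletPoly n).comp (w • X)) (fun z hz => ?_) x
  · simpa only [map_sum, aeval_comp_eq, _root_.sum_apply, inner_sum, Complex.re_sum] using le
  · have norm_mul_le : ‖w * z‖ ≤ 1 := (norm_mul w z).trans_le (mul_le_one₀ hw (norm_nonneg z) hz)
    simpa [eval_finsetSum] using sum_re_eval_dirichletPoly_nonneg norm_mul_le L

theorem toeplitzForm_le {T T' : H →L[ℂ] H} {c : ℝ}
    (hc : HarnackDominatedWith c T T') {N n : ℕ} (hn : N ≤ n) {h : ℕ → H}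
    (hh : ∀ m, N ≤ m → h m = 0) :
    toeplitzForm T N n h ≤ c * toeplitzForm T' N n h := by
  refine sub_nonneg.1 (nonneg_of_sum_range_nonneg (tendsto_atTop_of_eventually_const (i₀ := N)
    (u := fun l => c * toeplitzForm T' N l h - toeplitzForm T N l h) fun l hl => ?_) fun L => ?_)
  · simp only [toeplitzForm_eq_of_le _ hl hh, toeplitzForm_eq_of_le _ hn hh]
  set M := N + L + 1
  have sum_le := sum_le_sum fun (j : ZMod M) (_ : j ∈ univ) =>
    sum_re_inner_aeval_smul_dirichletPoly_le hc
      ((norm_star (ZMod.stdAddChar j)).trans (AddChar.norm_apply _ j)).le L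
      (∑ m ∈ range N, ZMod.stdAddChar j ^ m • h m)
  have sum_eq : ∀ S : H →L[ℂ] H, ∑ j : ZMod M, ∑ l ∈ range L,
      (⟪∑ m ∈ range N, ZMod.stdAddChar j ^ m • h m,
        aeval (star (ZMod.stdAddChar j) • S) (dirichletPoly l)
          (∑ m ∈ range N, ZMod.stdAddChar j ^ m • h m)⟫_ℂ).re =
      M * ∑ l ∈ range L, toeplitzForm S N l h := fun S => by
    rw [sum_comm, mul_sum]
    exact sum_congr rfl fun l hl => sum_re_inner_aeval_dirichletPoly_eq_toeplitzForm S
      (by have := mem_range.1 hl; omega) hh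
  rw [← mul_sum, sum_eq, sum_eq, mul_left_comm] at sum_le
  rw [sum_sub_distrib, ← mul_sum]
  exact sub_nonneg.2 (le_of_mul_le_mul_left sum_le (Nat.cast_pos.2 (NeZero.pos M)))

theorem norm_sum_pow_apply_sub_sq_le {T T' : H →L[ℂ] H} (hT : ‖T‖ ≤ 1) {c : ℝ}
    (hc : HarnackDominatedWith c T T') {N : ℕ} {g : ℕ → H} (hg : ∀ m, N ≤ m → g m = 0) :
    ‖∑ k ∈ range N, (T ^ k) ((T - T') (g k))‖ ^ 2 ≤
      c * ∑ k ∈ range N, (‖g k‖ ^ 2 - ‖T' (g k)‖ ^ 2) := by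
  set h : ℕ → H := fun m => shiftFun g m - T' (g m)
  have hh : ∀ m, N + 1 ≤ m → h m = 0 := by
    rintro (_ | m) hm
    · omega
    · simp [h, shiftFun, hg m (by omega), hg (m + 1) (by omega)]
  have sum_eq : ∑ k ∈ range N, (T ^ k) ((T - T') (g k)) = ∑ k ∈ range (N + 1), (T ^ k) (h k) := by
    simp only [h, map_sub, sum_sub_distrib, sub_apply]
    rw [sum_range_succ', sum_range_succ _ N, hg N le_rfl]
    simp [shiftFun]
  calc ‖∑ k ∈ range N, (T ^ k) ((T - T') (g k))‖ ^ 2 ≤ toeplitzForm T (N + 1) (N + 1) h :=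
        sum_eq ▸ norm_sum_pow_apply_sq_le_toeplitzForm hT le_rfl hh
    _ ≤ c * toeplitzForm T' (N + 1) (N + 1) h := toeplitzForm_le hc le_rfl hh
    _ = _ := by rw [toeplitzForm_shiftFun_sub T' (Nat.lt_succ_self N) hg]

end Toeplitz

section ShiftIntertwining

open Finset

variable {H : Type*} [NormedAddCommGroup H] [InnerProductSpace ℂ H]
  {G : Type*} [NormedAddCommGroup G] [InnerProductSpace ℂ G]
  {E : Type*} [NormedAddCommGroup E] [InnerProductSpace ℂ E]

/-- The linear map sending a finitely supported sequence `(g₀, g₁, …)` in `G` to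
`(D g₀, D g₁, …)` in `ℓ²_ℕ(E)`. -/
noncomputable def finsuppMapSeq (D : G →L[ℂ] E) : (ℕ →₀ G) →ₗ[ℂ] SeqSpace E :=
  Finsupp.lsum ℂ fun k => lp.lsingle 2 k ∘ₗ D.toLinearMap

theorem finsuppMapSeq_single (D : G →L[ℂ] E) (k : ℕ) (x : G) :
    finsuppMapSeq D (Finsupp.single k x) = lp.single 2 k (D x) := by
  simp [finsuppMapSeq]

theorem norm_finsuppMapSeq_sq (D : G →L[ℂ] E) (g : ℕ →₀ G) :
    ‖finsuppMapSeq D g‖ ^ 2 = ∑ k ∈ g.support, ‖D (g k)‖ ^ 2 := by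
  simpa [finsuppMapSeq, Finsupp.sum] using
    lp.norm_sum_single (p := 2) (by simp) (fun k => D (g k)) g.support

theorem denseRange_finsuppMapSeq {D : G →L[ℂ] E} (hD : DenseRange D) :
    DenseRange (finsuppMapSeq D) := by
  set R := (finsuppMapSeq D).range
  have single_mem : ∀ k x, lp.single 2 k x ∈ R.topologicalClosure := fun k x => by
    refine hD.induction_on x ?_ fun y => ?_
    · exact R.isClosed_topologicalClosure.preimage
        (lp.singleContinuousLinearMap ℂ (fun _ : ℕ => E) 2 k).continuous
    · exact subset_closure ⟨Finsupp.single k y, finsuppMapSeq_single D k y⟩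
  exact fun f => R.isClosed_topologicalClosure.mem_of_tendsto
    (lp.hasSum_single ENNReal.ofNat_ne_top f)
    (Filter.Eventually.of_forall fun s => sum_mem fun k _ => single_mem k (f k))

/-- Bounding the candidate `(D g₀, D g₁, …) ↦ ∑ Tᵏ A gₖ` on a dense subspace is all that is needed:
both identities can then be checked on that subspace. -/
theorem exists_comp_shift_eq [CompleteSpace H] {D : G →L[ℂ] E} (hD : DenseRange D)
    (A : G →L[ℂ] H) (T : H →L[ℂ] H) {C : ℝ} (hC : 0 ≤ C)
    (hA : ∀ g : ℕ →₀ G, ‖∑ k ∈ g.support, (T ^ k) (A (g k))‖ ^ 2 ≤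
      C * ∑ k ∈ g.support, ‖D (g k)‖ ^ 2) :
    ∃ B : SeqSpace E →L[ℂ] H, B ∘L inclZero E ∘L D = A ∧ B ∘L shift E = T ∘L B := by
  set f : (ℕ →₀ G) →ₗ[ℂ] H := Finsupp.lsum ℂ fun k => ((T ^ k) ∘L A).toLinearMap
  have norm_f_le : ∀ g, ‖f g‖ ≤ √C * ‖finsuppMapSeq D g‖ := fun g => by
    refine le_of_sq_le_sq ?_ (by positivity)
    rw [mul_pow, Real.sq_sqrt hC, norm_finsuppMapSeq_sq]
    exact hA g
  set B := f.extendOfNorm (finsuppMapSeq D)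
  have B_single : ∀ k x, B (lp.single 2 k (D x)) = (T ^ k) (A x) := fun k x => by
    rw [← finsuppMapSeq_single,
      LinearMap.extendOfNorm_eq (denseRange_finsuppMapSeq hD) ⟨_, norm_f_le⟩]
    exact Finsupp.sum_single_index (map_zero _)
  refine ⟨B, ContinuousLinearMap.ext fun x => B_single 0 x, DFunLike.coe_injective ?_⟩
  refine (denseRange_finsuppMapSeq hD).equalizer (by fun_prop) (by fun_prop) (funext fun g => ?_)
  induction g using Finsupp.induction_linear with
  | zero => simp
  | add g₁ g₂ h₁ h₂ =>
    simp only [Function.comp_apply, map_add] at h₁ h₂ ⊢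
    rw [h₁, h₂]
  | single k x =>
    simp only [Function.comp_apply, ContinuousLinearMap.comp_apply, finsuppMapSeq_single,
      shift_single, B_single, pow_succ', mul_apply_eq_comp]

theorem exists_shift_intertwining [CompleteSpace H] {T T' : H →L[ℂ] H} (hT : ‖T‖ ≤ 1)
    (hT' : ‖T'‖ ≤ 1) {c : ℝ} (hc : 0 ≤ c) (hTT' : HarnackDominatedWith c T T') :
    ∃ B : SeqSpace (defectSpace T') →L[ℂ] H,
      T = T' + B ∘L inclZero (defectSpace T') ∘L defectMap T' ∧
        B ∘L shift (defectSpace T') = T ∘L B := by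
  obtain ⟨B, hB, hshift⟩ := exists_comp_shift_eq (denseRange_defectMap T') (T - T') T hc fun g => by
    obtain ⟨N, hN⟩ := g.support.exists_nat_subset_range
    have g_eq_zero : ∀ k ∉ g.support, g k = 0 := fun k => Finsupp.notMem_support_iff.1
    simp only [norm_defectMap, norm_defectOp_sq hT']
    rw [sum_subset hN fun k _ hk => by rw [g_eq_zero k hk, map_zero, map_zero],
      sum_subset hN fun k _ hk => by simp [g_eq_zero k hk]]
    exact norm_sum_pow_apply_sub_sq_le hT hTT' fun k hk =>
      g_eq_zero k fun hmem => (mem_range.1 (hN hmem)).not_ge hk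
  exact ⟨B, by rw [hB, add_sub_cancel], hshift⟩

end ShiftIntertwining

section Harnack

open Metric Polynomial

theorem harnack_inequality {u : ℂ → ℝ} {c w : ℂ} {R : ℝ}
    (hu : InnerProductSpace.HarmonicContOnCl u (ball c R)) (hpos : ∀ z ∈ sphere c R, 0 ≤ u z)
    (hw : w ∈ ball c R) :
    (R - ‖w - c‖) / (R + ‖w - c‖) * u c ≤ u w ∧ u w ≤ (R + ‖w - c‖) / (R - ‖w - c‖) * u c := by
  have hR : 0 < R := pos_of_mem_ball hw
  have abs_R : |R| = R := abs_of_pos hR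
  have u_integrable : CircleIntegrable u c R :=
    (hu.continuousOn_ball.mono sphere_subset_closedBall).circleIntegrable hR.le
  have kernel_integrable : CircleIntegrable (Complex.re ∘ herglotzRieszKernel c w • u) c R :=
    ContinuousOn.circleIntegrable hR.le <|
      (Complex.continuous_re.comp_continuousOn
        (abs_R ▸ continuousOn_herglotzRieszKernel_sphere hw)).mul
      (hu.continuousOn_ball.mono sphere_subset_closedBall)
  have average_smul : ∀ a : ℝ, Real.circleAverage (a • u) c R = a * u c := fun a => by
    rw [Real.circleAverage_smul,
      InnerProductSpace.HarmonicContOnCl.circleAverage_eq (abs_R.symm ▸ hu), smul_eq_mul]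
  rw [← average_smul, ← average_smul, ← hu.circleAverage_re_herglotzRieszKernel_smul hw]
  constructor
  · refine Real.circleAverage_mono u_integrable.const_smul kernel_integrable fun z hz => ?_
    rw [abs_R] at hz
    exact mul_le_mul_of_nonneg_right (le_re_herglotzRieszKernel hz hw) (hpos z hz)
  · refine Real.circleAverage_mono kernel_integrable u_integrable.const_smul fun z hz => ?_
    rw [abs_R] at hz
    exact mul_le_mul_of_nonneg_right (re_herglotzRieszKernel_le hz hw) (hpos z hz)

variable {H : Type*} [NormedAddCommGroup H] [InnerProductSpace ℂ H]

theorem analyticAt_inner_aeval {F : ℂ → H →L[ℂ] H} {z : ℂ} (hF : AnalyticAt ℂ F z) (p : ℂ[X])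
    (x y : H) : AnalyticAt ℂ (fun w => ⟪x, aeval (F w) p y⟫_ℂ) z := by
  have analyticAt_aeval : AnalyticAt ℂ (fun w => aeval (F w) p) z := by
    simp only [aeval_eq_sum_range]
    exact Finset.analyticAt_fun_sum _ fun k _ => (hF.fun_pow k).fun_const_smul
  exact (innerSL ℂ x ∘L ContinuousLinearMap.apply ℂ H y).analyticAt _ |>.comp analyticAt_aeval

variable [CompleteSpace H]

theorem re_inner_realPart_apply_self (X : H →L[ℂ] H) (x : H) :
    (⟪(ℜ X : H →L[ℂ] H) x, x⟫_ℂ).re = (⟪x, X x⟫_ℂ).re := by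
  have adjoint_eq : (⟪star X x, x⟫_ℂ).re = (⟪x, X x⟫_ℂ).re := by
    rw [ContinuousLinearMap.star_eq_adjoint, ContinuousLinearMap.adjoint_inner_left]
  have symm_eq : (⟪X x, x⟫_ℂ).re = (⟪x, X x⟫_ℂ).re := inner_re_symm (𝕜 := ℂ) _ _
  rw [realPart_apply_coe, smul_apply, add_apply, inner_smul_left_eq_smul, Complex.smul_re,
    inner_add_left, Complex.add_re, adjoint_eq, symm_eq, smul_eq_mul]
  ring

theorem realPart_le_smul_realPart_iff (X Y : H →L[ℂ] H) (c : ℝ) :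
    (ℜ X : H →L[ℂ] H) ≤ c • (ℜ Y : H →L[ℂ] H) ↔
      ∀ x, (⟪x, X x⟫_ℂ).re ≤ c * (⟪x, Y x⟫_ℂ).re := by
  have isSelfAdjoint_sub : IsSelfAdjoint (c • (ℜ Y : H →L[ℂ] H) - (ℜ X : H →L[ℂ] H)) :=
    ((IsSelfAdjoint.all c).smul (ℜ Y).2).sub (ℜ X).2
  rw [ContinuousLinearMap.le_def, ContinuousLinearMap.isPositive_def',
    and_iff_right isSelfAdjoint_sub]
  refine forall_congr' fun x => ?_
  rw [ContinuousLinearMap.reApplyInnerSelf_apply, sub_apply, inner_sub_left, map_sub, sub_nonneg,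
    smul_apply, inner_smul_left_eq_smul, RCLike.re_to_complex, RCLike.re_to_complex,
    Complex.smul_re, re_inner_realPart_apply_self, re_inner_realPart_apply_self, smul_eq_mul]

theorem harnackDominated_iff {T T' : H →L[ℂ] H} :
    HarnackDominated T T' ↔ ∃ c : ℝ, 1 ≤ c ∧ HarnackDominatedWith c T T' := by
  simp only [HarnackDominated, HarnackDominatedWith, realPart_le_smul_realPart_iff]

theorem harnackEquivalent_of_analyticOnNhd {F : ℂ → H →L[ℂ] H}
    (hF : AnalyticOnNhd ℂ F (ball 0 1)) (hF_le : ∀ z ∈ ball (0 : ℂ) 1, ‖F z‖ ≤ 1)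
    {z₀ : ℂ} (hz₀ : z₀ ∈ ball (0 : ℂ) 1) : HarnackEquivalent (F 0) (F z₀) := by
  obtain ⟨r, hz₀r, hr1⟩ := exists_between (mem_ball_zero_iff.1 hz₀)
  have closedBall_subset : closedBall (0 : ℂ) r ⊆ ball 0 1 := closedBall_subset_ball hr1
  have harnack := fun (p : ℂ[X]) (hp : ∀ z : ℂ, ‖z‖ ≤ 1 → 0 ≤ (p.eval z).re) (x : H) =>
    harnack_inequality (u := fun z => (⟪x, aeval (F z) p x⟫_ℂ).re)
      (InnerProductSpace.HarmonicOnNhd.harmonicContOnCl fun z hz =>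
        (analyticAt_inner_aeval (hF z (closedBall_subset (closure_ball_subset_closedBall hz)))
          p x x).harmonicAt_re)
      (fun z hz => re_inner_aeval_nonneg
        (hF_le z (closedBall_subset (sphere_subset_closedBall hz))) hp x)
      (mem_ball_zero_iff.2 hz₀r)
  simp only [sub_zero] at harnack
  have radius_sub_pos : 0 < r - ‖z₀‖ := sub_pos.2 hz₀r
  have radius_add_pos : 0 < r + ‖z₀‖ := by linarith [norm_nonneg z₀]
  have one_le : 1 ≤ (r + ‖z₀‖) / (r - ‖z₀‖) := by
    rw [one_le_div radius_sub_pos]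
    linarith [norm_nonneg z₀]
  refine ⟨harnackDominated_iff.2 ⟨_, one_le, fun p hp x => ?_⟩,
    harnackDominated_iff.2 ⟨_, one_le, fun p hp x => (harnack p hp x).2⟩⟩
  rw [← inv_div, ← inv_mul_le_iff₀ (by positivity), inv_inv]
  exact (harnack p hp x).1

end Harnack

end HarnackShmulyan

theorem mainTheorem1 {H : Type*} [NormedAddCommGroup H] [InnerProductSpace ℂ H] [CompleteSpace H]
    (T T' : H →L[ℂ] H) (hT : ‖T‖ ≤ 1) (hT' : ‖T'‖ ≤ 1)
    (hqn : HarnackShmulyan.IsQuasiNormal T.adjoint)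
    (hTT' : Commute T T')
    (hTT'T' : Commute T (T'.adjoint * T'))
    (hT'TT : Commute T' (T * T.adjoint)) :
    List.TFAE [
      HarnackShmulyan.HarnackDominated T T',
      HarnackShmulyan.HarnackEquivalent T T',
      HarnackShmulyan.ShmulyanEquivalent T T',
      ∃ z₀ ∈ Metric.ball (0 : ℂ) 1, ∃ F : ℂ → H →L[ℂ] H,
        AnalyticOnNhd ℂ F (Metric.ball 0 1) ∧ (∀ z ∈ Metric.ball (0 : ℂ) 1, ‖F z‖ ≤ 1) ∧
          F 0 = T ∧ F z₀ = T',
      ∃ B : HarnackShmulyan.SeqSpace (HarnackShmulyan.defectSpace T') →L[ℂ] H,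
        T = T' + B ∘L HarnackShmulyan.inclZero (HarnackShmulyan.defectSpace T') ∘L
            HarnackShmulyan.defectMap T' ∧
          B ∘L HarnackShmulyan.shift (HarnackShmulyan.defectSpace T') = T ∘L B] := by
  tfae_have 2 → 1 := fun h => h.1
  tfae_have 1 → 5 := by
    intro h
    obtain ⟨c, hc, h⟩ := HarnackShmulyan.harnackDominated_iff.1 h
    exact HarnackShmulyan.exists_shift_intertwining hT hT' (zero_le_one.trans hc) h
  tfae_have 5 → 3 := by
    rintro ⟨B, hTB, hB⟩
    exact HarnackShmulyan.shmulyanEquivalent_of_comp_shift_eq hT hT' hqn hTT' hTT'T' hT'TT hTB hB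
  tfae_have 3 → 4 := fun h => h.exists_analyticOnNhd hT hT'
  tfae_have 4 → 2 := by
    rintro ⟨z₀, hz₀, F, hF, hF_le, rfl, rfl⟩
    exact HarnackShmulyan.harnackEquivalent_of_analyticOnNhd hF hF_le hz₀
  tfae_finish
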